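/- Let $X$ be a connected, locally path connected topological space and $x\in X$. Let $\pi_1^{qtop}(X,x)$ denote $\pi_1(X,x)$ with the quotient topology induced by the map $\Omega(X,x)\to\pi_1(X,x)$, $\gamma\mapsto[\gamma]$, where the loop space $\Omega(X,x)$ carries the compact-open topology. The core of a subgroup $H\le\pi_1(X,x)$ is $\bigcap_{g\in\pi_1(X,x)} gHg^{-1}$. A connected covering space of $X$ is a covering map $p:\widetilde X\to X$ with $\widetilde X$ connected (in particular nonempty); two of them, $p:\widetilde X\to X$ and $q:\widetilde Y\to X$, are equivalent if there is a homeomorphism $h:\widetilde X\to\widetilde Y$ with $q\circ h=p$. Then every connected covering $p:\widetilde X\to X$ has nonempty fiber over $x$; for every $\tilde x\in p^{-1}(x)$ the core of $p_*\pi_1(\widetilde X,\tilde x)$ in $\pi_1(X,x)$ is open in $\pi_1^{qtop}(X,x)$; and sending the equivalence class of $p$ to the conjugacy class of $p_*\pi_1(\widetilde X,\tilde x)$, for any $\tilde x\in p^{-1}(x)$, is a well-defined bijection from the set of equivalence classes of connected covering spaces of $X$ onto the set of conjugacy classes of those subgroups of $\pi_1(X,x)$ whose core is open in $\pi_1^{qtop}(X,x)$.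 -/

import Mathlib

universe u

open scoped Topology

/-- Two subgroups are conjugate: `K = g H g⁻¹` for some `g`. -/
def Subgroup.ConjRel {G : Type u} [Group G] (H K : Subgroup G) : Prop :=
  ∃ g : G, K = H.map (MulAut.conj g).toMonoidHom

theorem Subgroup.conjRel_equivalence {G : Type u} [Group G] :
    Equivalence (Subgroup.ConjRel (G := G)) where
  refl H := ⟨1, by ext a; simp⟩
  symm := by
    rintro H K ⟨g, hg⟩
    refine ⟨g⁻¹, ?_⟩
    rw [hg, Subgroup.map_map]
    ext a
    simp [mul_assoc]
  trans := by
    rintro H K L ⟨g, hg⟩ ⟨k, hk⟩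
    refine ⟨k * g, ?_⟩
    rw [hk, hg, Subgroup.map_map]
    congr 1
    ext a
    simp [mul_assoc]

/-- The topology of the quasitopological fundamental group: the quotient topology induced by
the map `γ ↦ [γ]` from the loop space `Ω(X, x) = Path x x` with the compact-open topology. -/
@[reducible]
def FundamentalGroup.qtop {X : Type u} [TopologicalSpace X] (x : X) :
    TopologicalSpace (FundamentalGroup X x) :=
  TopologicalSpace.coinduced
    (fun γ : Path x x => FundamentalGroup.fromPath (Path.Homotopic.Quotient.mk γ))
    inferInstance

/-- The core `⋂ g, g H g⁻¹` of `H` in the fundamental group is open in the quasitopological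
fundamental group. -/
def FundamentalGroup.HasOpenCore {X : Type u} [TopologicalSpace X] {x : X}
    (H : Subgroup (FundamentalGroup X x)) : Prop :=
  IsOpen[FundamentalGroup.qtop x] (H.normalCore : Set (FundamentalGroup X x))

/-- The subgroups of the fundamental group whose core is open, up to conjugacy in the
fundamental group. -/
def FundamentalGroup.openCoreSetoid {X : Type u} [TopologicalSpace X] (x : X) :
    Setoid {H : Subgroup (FundamentalGroup X x) // FundamentalGroup.HasOpenCore H} where
  r H K := Subgroup.ConjRel H.1 K.1
  iseqv :=
    { refl := fun H => Subgroup.conjRel_equivalence.refl H.1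
      symm := fun h => Subgroup.conjRel_equivalence.symm h
      trans := fun h k => Subgroup.conjRel_equivalence.trans h k }

/-- Conjugacy classes of subgroups of the fundamental group with open core. -/
def FundamentalGroup.OpenCoreConjClasses {X : Type u} [TopologicalSpace X] (x : X) : Type u :=
  Quotient (FundamentalGroup.openCoreSetoid x)

/-- A connected covering space `proj : E → X` (connected spaces are nonempty). -/
structure ConnectedCovering (X : Type u) [TopologicalSpace X] where
  E : Type u
  [top : TopologicalSpace E]
  [connected : ConnectedSpace E]
  proj : C(E, X)
  isCovering : IsCoveringMap proj

attribute [instance] ConnectedCovering.top ConnectedCovering.connected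

/-- Two coverings of `X` are equivalent if there is a homeomorphism between their total spaces
commuting with the projections to `X`. -/
def ConnectedCovering.setoid (X : Type u) [TopologicalSpace X] : Setoid (ConnectedCovering X) where
  r p q := ∃ h : p.E ≃ₜ q.E, ∀ e, q.proj (h e) = p.proj e
  iseqv :=
    { refl := fun p => ⟨Homeomorph.refl _, fun _ => rfl⟩
      symm := by
        rintro p q ⟨h, hh⟩
        exact ⟨h.symm, fun e => by rw [← hh, h.apply_symm_apply]⟩
      trans := by
        rintro p q r ⟨h, hh⟩ ⟨k, hk⟩
        exact ⟨h.trans k, fun e => by rw [Homeomorph.trans_apply, hk, hh]⟩ }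

/-- Equivalence classes of connected covering spaces of `X`. -/
def ConnectedCovering.Classes (X : Type u) [TopologicalSpace X] : Type (u + 1) :=
  Quotient (ConnectedCovering.setoid X)

/-- The image `p_* π₁(E, e)` in `π₁(X, x)`, for a point `e` of the fiber over `x`. -/
noncomputable def ConnectedCovering.imageSubgroup {X : Type u} [TopologicalSpace X] {x : X}
    (p : ConnectedCovering X) (e : p.E) (he : p.proj e = x) :
    Subgroup (FundamentalGroup X x) :=
  (FundamentalGroup.mapOfEq p.proj he).range

/-! The fundamental group acts on the fiber over `x` by monodromy. For a connected covering the
action is transitive and the image subgroup at a point of the fiber is its stabilizer. Hence moving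
the point conjugates the subgroup, and the core is the kernel of the action. Conjugate image
subgroups give equivalent coverings by the lifting criterion. All this is classical; the topology on
the fundamental group enters twice.

The kernel is open because closeness of lifts is uniform in their starting point. Subdivide a path
so that each piece lies in an evenly covered set; lifts of it and of a nearby path with a common
start run through the same sheets, whichever sheet they start in (`eventually_lift_apply_one_eq`).
One neighborhood thus serves the whole fiber, whereas arguing point by point would only make each
stabilizer open.

Conversely, let `H` have open core. Openness near a constant loop gives each point a neighborhood
whose loops, closed up to loops at `x`, lie in the core. The core acts trivially on the cosets of
`H`, so transport of cosets along paths is trivial over these neighborhoods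
(`HasOpenCore.localSystem`), and the trivial pieces glue to a covering (`LocalSystem.core`). Its
monodromy is the transport, and the stabilizer of the trivial coset is conjugate to `H`. -/

open scoped unitInterval

/-! ### Lifts of nearby paths and openness of the monodromy kernel -/

namespace IsCoveringMap

variable {E X : Type*} [TopologicalSpace E] [TopologicalSpace X] {p : E → X}

/-- A covering map with nonempty total space and path connected base is surjective. -/
theorem surjective_of_pathConnectedSpace [Nonempty E] [PathConnectedSpace X]
    (cov : IsCoveringMap p) : Function.Surjective p := fun x =>
  let e := Classical.arbitrary E
  let γ := PathConnectedSpace.somePath (p e) x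
  ⟨_, (cov.monodromy (.mk γ) ⟨e, rfl⟩).2⟩

/-- The total space of a covering of a locally path connected space is locally path connected. -/
theorem locallyPathConnectedSpace [LocallyPathConnectedSpace X]
    (cov : IsCoveringMap p) : LocallyPathConnectedSpace E := by
  rw [locallyPathConnectedSpace_iff_pathComponentIn_mem_nhds]
  intro e W hW he
  obtain ⟨U, hU, hUp⟩ := isLocalHomeomorph_iff_isOpenEmbedding_restrict.mp cov.isLocalHomeomorph e
  have := hUp.locallyPathConnectedSpace
  let e' : U := ⟨e, mem_of_mem_nhds hU⟩
  have h := Filter.image_mem_map (m := Subtype.val) <|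
    pathComponentIn_mem_nhds (x := e') (F := Subtype.val ⁻¹' W)
      ((hW.preimage continuous_subtype_val).mem_nhds he)
  rw [map_nhds_subtype_coe_eq_nhds (mem_of_mem_nhds hU) hU] at h
  refine Filter.mem_of_superset h ?_
  rintro _ ⟨a, ha, rfl⟩
  obtain ⟨γ, hγ⟩ := ha
  exact ⟨γ.map continuous_subtype_val, hγ⟩

/-- Over the base set of a trivialization with discrete fiber, the points of a preconnected set
have the same second coordinate. -/
theorem _root_.Bundle.Trivialization.snd_eq_of_isPreconnected {F : Type*} [TopologicalSpace F]
    [DiscreteTopology F] (t : Bundle.Trivialization F p) {S : Set E} (hS : IsPreconnected S)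
    (hSt : S ⊆ p ⁻¹' t.baseSet) {a b : E} (ha : a ∈ S) (hb : b ∈ S) : (t a).2 = (t b).2 := by
  have hc : ContinuousOn (fun e => (t e).2) S :=
    continuous_snd.comp_continuousOn (t.continuousOn_toFun.mono (t.source_eq ▸ hSt))
  exact hS.constant hc ha hb

/-- The sheet over a preconnected subset of the base set of a trivialization. -/
theorem _root_.Bundle.Trivialization.exists_isPreconnected {F : Type*} [TopologicalSpace F]
    (t : Bundle.Trivialization F p) {V : Set X} (hV : IsPreconnected V)
    (hVt : V ⊆ t.baseSet) {a b : E} (ha : p a ∈ V) (hb : p b ∈ V) (h : (t a).2 = (t b).2) :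
    ∃ S : Set E, IsPreconnected S ∧ S ⊆ p ⁻¹' V ∧ a ∈ S ∧ b ∈ S := by
  refine ⟨(fun v => t.toOpenPartialHomeomorph.symm (v, (t a).2)) '' V, hV.image _ ?_, ?_,
    ⟨p a, ha, ?_⟩, ⟨p b, hb, ?_⟩⟩
  · refine t.continuousOn_invFun.comp (by fun_prop) fun v hv => ?_
    rw [t.target_eq]
    exact ⟨hVt hv, trivial⟩
  · rintro _ ⟨v, hv, rfl⟩
    rw [Set.mem_preimage, t.proj_symm_apply' (hVt hv)]
    exact hv
  · exact t.symm_apply_mk_proj (t.mem_source.mpr (hVt ha))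
  · rw [h]
    exact t.symm_apply_mk_proj (t.mem_source.mpr (hVt hb))

/-- Lifts of two sufficiently close paths with a common start stay, at each time, in a common
preconnected set over a small neighborhood; how close the paths must be does not depend on the start
of the lifts. -/
theorem eventually_exists_isPreconnected [LocallyConnectedSpace X]
    (cov : IsCoveringMap p) (hp : Function.Surjective p) (γ : C(I, X)) (t : I) (V : Set X)
    (hV : V ∈ 𝓝 (γ t)) :
    ∀ᶠ δ : C(I, X) in 𝓝 γ, ∀ Γ Δ : C(I, E), p ∘ Γ = γ → p ∘ Δ = δ → Γ 0 = Δ 0 →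
      ∃ S : Set E, IsPreconnected S ∧ S ⊆ p ⁻¹' V ∧ Γ t ∈ S ∧ Δ t ∈ S := by
  let T (x : X) : Bundle.Trivialization (p ⁻¹' {x}) p :=
    haveI : Nonempty (p ⁻¹' {x}) := let ⟨e, he⟩ := hp x; ⟨⟨e, he⟩⟩
    (cov x).toTrivialization
  have hT (x : X) : x ∈ (T x).baseSet :=
    haveI : Nonempty (p ⁻¹' {x}) := let ⟨e, he⟩ := hp x; ⟨⟨e, he⟩⟩
    (cov x).mem_toTrivialization_baseSet
  obtain ⟨s, s_0, s_mono, ⟨n, hn⟩, hs⟩ := exists_monotone_Icc_subset_open_cover_unitInterval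
    (fun x => (T x).open_baseSet.preimage γ.continuous)
    fun t _ => Set.mem_iUnion.2 ⟨γ t, hT _⟩
  -- All `t` and `V` are kept in the induction: the step to `n + 1` uses time `s n` with the base
  -- set of the next trivialization as `V`.
  suffices H : ∀ n, ∀ t ∈ Set.Icc 0 (s n), ∀ V ∈ 𝓝 (γ t), ∀ᶠ δ : C(I, X) in 𝓝 γ, ∀ Γ Δ : C(I, E),
      p ∘ Γ = γ → p ∘ Δ = δ → Γ 0 = Δ 0 →
      ∃ S : Set E, IsPreconnected S ∧ S ⊆ p ⁻¹' V ∧ Γ t ∈ S ∧ Δ t ∈ S from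
    H n t ⟨bot_le, hn n le_rfl ▸ le_top⟩ V hV
  clear! t V
  intro n
  induction n with
  | zero =>
    intro t ht V hV
    obtain rfl : t = 0 := le_antisymm (s_0 ▸ ht.2) bot_le
    refine .of_forall fun δ Γ Δ hΓ _ h0 => ⟨{Γ 0}, isPreconnected_singleton, ?_, rfl, h0.symm⟩
    rw [Set.singleton_subset_iff, Set.mem_preimage, ← Function.comp_apply (f := p), hΓ]
    exact mem_of_mem_nhds hV
  | succ n ih =>
    intro t ht V hV
    obtain hle | hlt := le_total t (s n)
    · exact ih t ⟨ht.1, hle⟩ V hV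
    obtain ⟨x, hx⟩ := hs n
    have hsub : Set.Icc (s n) t ⊆ γ ⁻¹' (T x).baseSet := (Set.Icc_subset_Icc_right ht.2).trans hx
    have hx_t : (T x).baseSet ∈ 𝓝 (γ t) := (T x).open_baseSet.mem_nhds (hsub ⟨hlt, le_rfl⟩)
    -- Only the agreement of sheets passes from `s n` to `t`; the preconnected set over `V` is
    -- rebuilt as one sheet over a connected `V'` inside both `V` and the base set.
    obtain ⟨V', ⟨hV'_open, htV', hV'_conn⟩, hV'⟩ :=
      (LocallyConnectedSpace.open_connected_basis (γ t)).mem_iff.mp (Filter.inter_mem hV hx_t)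
    have : DiscreteTopology (p ⁻¹' {x}) := (cov x).1
    filter_upwards [ih (s n) ⟨bot_le, le_rfl⟩ _
      ((T x).open_baseSet.mem_nhds (hsub ⟨le_rfl, hlt⟩)),
      ContinuousMap.eventually_mapsTo isCompact_Icc (T x).open_baseSet hsub,
      ContinuousMap.eventually_mapsTo (isCompact_singleton (x := t)) hV'_open
        (Set.mapsTo_singleton.mpr htV')] with δ h1 h2 h3 Γ Δ hΓ hΔ h0
    obtain ⟨S, hS, hSx, hΓS, hΔS⟩ := h1 Γ Δ hΓ hΔ h0
    have key (Γ : C(I, E)) (γ : C(I, X)) (hΓ : p ∘ Γ = γ)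
        (h : Set.MapsTo γ (Set.Icc (s n) t) (T x).baseSet) :
        (T x (Γ (s n))).2 = (T x (Γ t)).2 := by
      refine (T x).snd_eq_of_isPreconnected (isPreconnected_Icc.image Γ Γ.continuous.continuousOn)
        ?_ ⟨_, ⟨le_rfl, hlt⟩, rfl⟩ ⟨_, ⟨hlt, le_rfl⟩, rfl⟩
      rintro _ ⟨r, hr, rfl⟩
      rw [Set.mem_preimage, ← Function.comp_apply (f := p), hΓ]
      exact h hr
    have hΓt : p (Γ t) = γ t := congr_fun hΓ t
    have hΔt : p (Δ t) = δ t := congr_fun hΔ t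
    obtain ⟨S', hS', hS'V, hm⟩ := (T x).exists_isPreconnected hV'_conn.isPreconnected
      (fun v hv => (hV' hv).2) (a := Γ t) (b := Δ t) (hΓt ▸ htV') (hΔt ▸ h3 rfl)
      ((key Γ γ hΓ hsub).symm.trans
        (((T x).snd_eq_of_isPreconnected hS hSx hΓS hΔS).trans (key Δ δ hΔ h2)))
    exact ⟨S', hS', fun e he => (hV' (hS'V he)).1, hm⟩

/-- Lifts of two sufficiently close paths with a common start and projections with a common end
have a common end; how close the paths must be does not depend on the start of the lifts. -/
theorem eventually_lift_apply_one_eq [LocallyConnectedSpace X]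
    (cov : IsCoveringMap p) (hp : Function.Surjective p) (γ : C(I, X)) :
    ∀ᶠ δ : C(I, X) in 𝓝 γ, ∀ Γ Δ : C(I, E), p ∘ Γ = γ → p ∘ Δ = δ → Γ 0 = Δ 0 → γ 1 = δ 1 →
      Γ 1 = Δ 1 := by
  have : Nonempty (p ⁻¹' {γ 1}) := let ⟨e, he⟩ := hp (γ 1); ⟨⟨e, he⟩⟩
  let T := (cov (γ 1)).toTrivialization
  have hT : γ 1 ∈ T.baseSet := (cov (γ 1)).mem_toTrivialization_baseSet
  have : DiscreteTopology (p ⁻¹' {γ 1}) := (cov (γ 1)).1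
  filter_upwards [cov.eventually_exists_isPreconnected hp γ 1 _ (T.open_baseSet.mem_nhds hT)]
    with δ h Γ Δ hΓ hΔ h0 h1
  obtain ⟨S, hS, hST, hΓS, hΔS⟩ := h Γ Δ hΓ hΔ h0
  -- In the trivialization the two ends share the sheet because of `S`, and the base point by
  -- assumption.
  refine T.injOn (T.mem_source.mpr (hST hΓS)) (T.mem_source.mpr (hST hΔS)) (Prod.ext ?_
    (T.snd_eq_of_isPreconnected hS hST hΓS hΔS))
  refine (T.coe_fst' (hST hΓS)).trans (.trans ?_ (T.coe_fst' (hST hΔS)).symm)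
  exact (congr_fun hΓ 1).trans (h1.trans (congr_fun hΔ 1).symm)

/-- The kernel of the monodromy action is open. -/
theorem isOpen_setOf_monodromy_eq_id [LocallyConnectedSpace X]
    (cov : IsCoveringMap p) (hp : Function.Surjective p) (x : X) :
    IsOpen {γ : Path x x | cov.monodromy (.mk γ) = id} := by
  rw [isOpen_iff_eventually]
  intro γ hγ
  -- The neighborhood of `γ` is independent of the start of the lifts, so it works for all points of
  -- the fiber at once.
  filter_upwards [(continuous_induced_dom (f := fun γ : Path x x => (γ : C(I, X)))).continuousAt
    (cov.eventually_lift_apply_one_eq hp (γ : C(I, X)))] with δ hδ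
  ext e
  rw [← hγ]
  exact (hδ _ _ (cov.liftPath_lifts γ e (γ.source.trans e.2.symm))
    (cov.liftPath_lifts δ e (δ.source.trans e.2.symm))
    (by rw [cov.liftPath_zero, cov.liftPath_zero]) (by simp)).symm

end IsCoveringMap

/-! ### The image subgroup as a stabilizer of the monodromy action -/

namespace IsCoveringMap

variable {E X : Type*} [TopologicalSpace E] [TopologicalSpace X] {p : E → X}

/-- The image of the fundamental group of a covering space is the stabilizer of the base point
under the monodromy action. -/
theorem range_mapOfEq_eq_stabilizer (cov : IsCoveringMap p) {x : X} (e : E) (he : p e = x) :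
    letI := cov.fundamentalGroupMulAction x
    (FundamentalGroup.mapOfEq ⟨p, cov.continuous⟩ he).range =
      MulAction.stabilizer (FundamentalGroup X x) (⟨e, he⟩ : p ⁻¹' {x}) := by
  let _ := cov.fundamentalGroupMulAction x
  subst he
  ext g
  constructor
  · rintro ⟨q, rfl⟩
    refine cov.monodromy_eq_of_map_eq (ex := ⟨e, rfl⟩) (ey := ⟨e, rfl⟩) q ?_
    rw [FundamentalGroup.mapOfEq_apply]
    simp
  · intro h
    have hm : (cov.monodromy g ⟨e, rfl⟩ : E) = e := congrArg Subtype.val h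
    -- The lift of `g` from `e` ends at `e`, so it is a loop with image `g`.
    refine ⟨(cov.liftPathQuotient g ⟨e, rfl⟩).cast rfl hm.symm, ?_⟩
    rw [FundamentalGroup.mapOfEq_apply, Path.Homotopic.Quotient.map_cast,
      cov.map_liftPathQuotient, Path.Homotopic.Quotient.cast_cast]
    exact (Path.Homotopic.Quotient.cast_cast (x := p e) (y := p e) g _ _ _ _).trans
      (Path.Homotopic.Quotient.cast_rfl_rfl (x := p e) (y := p e) g)

/-- The monodromy action on a fiber of a path connected covering space is transitive. -/
theorem isPretransitive_fundamentalGroup [PathConnectedSpace E] (cov : IsCoveringMap p) (x : X) :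
    letI := cov.fundamentalGroupMulAction x
    MulAction.IsPretransitive (FundamentalGroup X x) (p ⁻¹' {x}) := by
  let _ := cov.fundamentalGroupMulAction x
  refine ⟨fun e e' => ?_⟩
  let Γ : Path.Homotopic.Quotient (e : E) e' := .mk (PathConnectedSpace.somePath (e : E) e')
  refine ⟨(Γ.map ⟨p, cov.continuous⟩).cast e.2.symm e'.2.symm, ?_⟩
  exact cov.monodromy_eq_of_map_eq Γ <| .symm <|
    (Path.Homotopic.Quotient.cast_cast _ _ _ _ _).trans (Path.Homotopic.Quotient.cast_rfl_rfl _)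

/-- The core of the image of the fundamental group of a path connected covering space consists of
the classes that act trivially on the fiber. -/
theorem mem_normalCore_range_mapOfEq_iff [PathConnectedSpace E] (cov : IsCoveringMap p) {x : X}
    (e : E) (he : p e = x) (g : FundamentalGroup X x) :
    g ∈ (FundamentalGroup.mapOfEq ⟨p, cov.continuous⟩ he).range.normalCore ↔
      cov.monodromy g = id := by
  let _ := cov.fundamentalGroupMulAction x
  have := cov.isPretransitive_fundamentalGroup x
  rw [cov.range_mapOfEq_eq_stabilizer]
  constructor
  · intro h
    ext1 e'
    obtain ⟨k, rfl⟩ := MulAction.exists_smul_eq (FundamentalGroup X x) (⟨e, he⟩ : p ⁻¹' {x}) e'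
    have hk : k⁻¹ * g * k⁻¹⁻¹ ∈ MulAction.stabilizer _ (⟨e, he⟩ : p ⁻¹' {x}) := h k⁻¹
    rw [MulAction.mem_stabilizer_iff, mul_assoc, mul_smul, inv_smul_eq_iff, inv_inv,
      mul_smul] at hk
    exact hk
  · intro h b
    have h' (e' : p ⁻¹' {x}) : g • e' = e' := congr_fun h e'
    rw [MulAction.mem_stabilizer_iff, mul_smul, mul_smul, h', smul_inv_smul]

end IsCoveringMap

/-! ### Image subgroups of connected coverings -/

namespace ConnectedCovering

variable {X : Type u} [TopologicalSpace X]

instance pathConnectedSpace [LocallyPathConnectedSpace X] (p : ConnectedCovering X) :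
    PathConnectedSpace p.E :=
  have := p.isCovering.locallyPathConnectedSpace
  .of_locallyPathConnectedSpace

theorem surjective [LocallyPathConnectedSpace X] [ConnectedSpace X] (p : ConnectedCovering X) :
    Function.Surjective p.proj :=
  have : PathConnectedSpace X := .of_locallyPathConnectedSpace
  p.isCovering.surjective_of_pathConnectedSpace

/-- The preimage of the core in the loop space is the set of loops with trivial monodromy. -/
theorem hasOpenCore_imageSubgroup [LocallyPathConnectedSpace X] [ConnectedSpace X]
    (p : ConnectedCovering X) {x : X} (e : p.E) (he : p.proj e = x) : FundamentalGroup.HasOpenCore (p.imageSubgroup e he) := by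
  refine isOpen_coinduced.mpr ?_
  convert p.isCovering.isOpen_setOf_monodromy_eq_id p.surjective x
  ext γ
  exact p.isCovering.mem_normalCore_range_mapOfEq_iff e he _

/-- Points of one orbit have conjugate stabilizers, and the fiber is a single orbit. -/
theorem conjRel_imageSubgroup [LocallyPathConnectedSpace X]
    (p : ConnectedCovering X) {x : X} (e e' : p.E)
    (he : p.proj e = x) (he' : p.proj e' = x) :
    Subgroup.ConjRel (p.imageSubgroup e he) (p.imageSubgroup e' he') := by
  let _ := p.isCovering.fundamentalGroupMulAction x
  have := p.isCovering.isPretransitive_fundamentalGroup x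
  obtain ⟨g, hg⟩ := MulAction.exists_smul_eq (FundamentalGroup X x)
    (⟨e, he⟩ : p.proj ⁻¹' {x}) ⟨e', he'⟩
  refine ⟨g, ?_⟩
  have h := p.isCovering.range_mapOfEq_eq_stabilizer e he
  have h' := p.isCovering.range_mapOfEq_eq_stabilizer e' he'
  rw [← hg, MulAction.stabilizer_smul_eq_stabilizer_map_conj, ← h] at h'
  exact h'

/-- A conjugate of the image subgroup is the image subgroup at another point of the fiber. -/
theorem exists_imageSubgroup_eq_of_conjRel (p : ConnectedCovering X) {x : X} (e : p.E)
    (he : p.proj e = x) {K : Subgroup (FundamentalGroup X x)}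
    (hK : Subgroup.ConjRel (p.imageSubgroup e he) K) :
    ∃ (e' : p.E) (he' : p.proj e' = x), p.imageSubgroup e' he' = K := by
  let _ := p.isCovering.fundamentalGroupMulAction x
  obtain ⟨g, rfl⟩ := hK
  refine ⟨(g • (⟨e, he⟩ : p.proj ⁻¹' {x}) : p.proj ⁻¹' {x}), (g • _ : p.proj ⁻¹' {x}).2, ?_⟩
  have h := p.isCovering.range_mapOfEq_eq_stabilizer e he
  have h' := p.isCovering.range_mapOfEq_eq_stabilizer _
    (g • (⟨e, he⟩ : p.proj ⁻¹' {x}) : p.proj ⁻¹' {x}).2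
  rw [Subtype.coe_eta, MulAction.stabilizer_smul_eq_stabilizer_map_conj, ← h] at h'
  exact h'

theorem exists_lift_of_imageSubgroup_le [LocallyPathConnectedSpace X]
    (p q : ConnectedCovering X) {x : X} {e : p.E} {f : q.E}
    (he : p.proj e = x) (hf : q.proj f = x) (h : p.imageSubgroup e he ≤ q.imageSubgroup f hf) :
    ∃ F : C(p.E, q.E), F e = f ∧ ∀ a, q.proj (F a) = p.proj a := by
  subst he
  have := p.isCovering.locallyPathConnectedSpace
  obtain ⟨F, ⟨hF, hF'⟩, -⟩ := q.isCovering.existsUnique_continuousMap_lifts_of_range_le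
    (f := p.proj) (a₀ := e) hf (le_trans (by
      rintro _ ⟨a, rfl⟩
      refine ⟨a, ?_⟩
      rw [FundamentalGroup.mapOfEq_apply]
      exact Path.Homotopic.Quotient.cast_rfl_rfl _) h)
  exact ⟨F, hF, congr_fun hF'⟩

/-- Each projection lifts through the other; both composites of the two lifts fix a base point and
cover the identity, so they are identities by uniqueness of lifts. -/
theorem equiv_of_imageSubgroup_eq [LocallyPathConnectedSpace X]
    (p q : ConnectedCovering X) {x : X} {e : p.E} {f : q.E}
    (he : p.proj e = x) (hf : q.proj f = x) (h : p.imageSubgroup e he = q.imageSubgroup f hf) :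
    (ConnectedCovering.setoid X) p q := by
  obtain ⟨F, hF, hF'⟩ := exists_lift_of_imageSubgroup_le p q he hf h.le
  obtain ⟨G, hG, hG'⟩ := exists_lift_of_imageSubgroup_le q p hf he h.ge
  have hGF : G ∘ F = id := p.isCovering.eq_of_comp_eq (by fun_prop) continuous_id
    (by ext a; simp [hG', hF']) e (by simp [hF, hG])
  have hFG : F ∘ G = id := q.isCovering.eq_of_comp_eq (by fun_prop) continuous_id
    (by ext a; simp [hG', hF']) f (by simp [hF, hG])
  exact ⟨⟨⟨F, G, congr_fun hGF, congr_fun hFG⟩, F.continuous, G.continuous⟩, hF'⟩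

theorem imageSubgroup_le_of_map (p q : ConnectedCovering X) {x : X} (e : p.E)
    (he : p.proj e = x) (F : C(p.E, q.E)) (hF : ∀ a, q.proj (F a) = p.proj a) :
    p.imageSubgroup e he ≤ q.imageSubgroup (F e) ((hF e).trans he) := by
  rintro _ ⟨⟨γ⟩, rfl⟩
  refine ⟨.mk (γ.map F.continuous), ?_⟩
  refine (FundamentalGroup.mapOfEq_apply ..).trans
    (.trans ?_ (FundamentalGroup.mapOfEq_apply ..).symm)
  refine congrArg Path.Homotopic.Quotient.mk ?_
  ext t
  exact hF (γ t)

theorem imageSubgroup_eq_of_equiv (p q : ConnectedCovering X) {x : X} (e : p.E)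
    (he : p.proj e = x) (h : p.E ≃ₜ q.E) (hh : ∀ a, q.proj (h a) = p.proj a) :
    p.imageSubgroup e he = q.imageSubgroup (h e) ((hh e).trans he) := by
  refine le_antisymm (p.imageSubgroup_le_of_map q e he h hh) ?_
  have := q.imageSubgroup_le_of_map p (h e) ((hh e).trans he) h.symm
    fun a => by rw [ContinuousMap.coe_coe, ← hh, h.apply_symm_apply]
  convert this
  exact (h.symm_apply_apply e).symm

end ConnectedCovering

/-! ### Local systems and the coverings glued from them -/

/-- The data to build a covering space with fiber `F` out of an action of the path classes on `F`:
every point has a path connected open neighborhood the loops of which act trivially. -/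
structure LocalSystem (X : Type*) [TopologicalSpace X] (F : Type*) where
  /-- The transport along path classes. -/
  transport : ∀ {y z : X}, Path.Homotopic.Quotient y z → F → F
  transport_refl : ∀ y f, transport (.refl y) f = f
  transport_trans : ∀ {y z w : X} (c : Path.Homotopic.Quotient y z)
    (d : Path.Homotopic.Quotient z w) (f : F),
    transport (c.trans d) f = transport d (transport c f)
  /-- The neighborhoods over which the local system is trivial. -/
  nhd : X → Set X
  isOpen_nhd : ∀ y, IsOpen (nhd y)
  mem_nhd : ∀ y, y ∈ nhd y
  isPathConnected_nhd : ∀ y, IsPathConnected (nhd y)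
  transport_loop : ∀ {y : X} (l : Path y y), (∀ t, l t ∈ nhd y) → ∀ f, transport (.mk l) f = f

namespace LocalSystem

variable {X : Type*} [TopologicalSpace X] {F : Type*} (L : LocalSystem X F)

theorem transport_symm_transport {y z : X} (c : Path.Homotopic.Quotient y z) (f : F) :
    L.transport c.symm (L.transport c f) = f := by
  rw [← L.transport_trans, Path.Homotopic.Quotient.trans_symm, L.transport_refl]

theorem transport_transport_symm {y z : X} (c : Path.Homotopic.Quotient y z) (f : F) :
    L.transport c (L.transport c.symm f) = f := by
  rw [← L.transport_trans, Path.Homotopic.Quotient.symm_trans, L.transport_refl]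

/-- Parallel paths in one of the trivializing neighborhoods act in the same way. -/
theorem transport_eq_of_mem {y a b : X} (p q : Path a b) (hp : ∀ t, p t ∈ L.nhd y)
    (hq : ∀ t, q t ∈ L.nhd y) (f : F) : L.transport (.mk p) f = L.transport (.mk q) f := by
  have ha : a ∈ L.nhd y := p.source ▸ hp 0
  obtain ⟨r, hr⟩ := (L.isPathConnected_nhd y).joinedIn y (L.mem_nhd y) a ha
  -- `transport_loop` concerns loops at `y` only, so `p` followed by the reverse of `q` is joined to
  -- `y` by `r`. It is applied to `f` carried back along `r`, so that the first `r` cancels.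
  have h := L.transport_loop ((r.trans (p.trans q.symm)).trans r.symm) (fun t => by
    have : (r.trans (p.trans q.symm)).trans r.symm t ∈
      Set.range ((r.trans (p.trans q.symm)).trans r.symm) := ⟨t, rfl⟩
    rw [Path.trans_range, Path.trans_range, Path.trans_range, Path.symm_range, Path.symm_range]
      at this
    rcases this with (⟨s, hs⟩ | ⟨s, hs⟩ | ⟨s, hs⟩) | ⟨s, hs⟩ <;> rw [← hs]
    exacts [hr s, hp s, hq s, hr s]) (L.transport (.symm (.mk r)) f)
  simp only [Path.Homotopic.Quotient.mk_trans, Path.Homotopic.Quotient.mk_symm,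
    L.transport_trans, L.transport_transport_symm] at h
  have h' := congrArg (fun f => L.transport (.mk q) (L.transport (.mk r) f)) h
  simpa only [L.transport_transport_symm] using h'

open Classical in
/-- A path from `y` to `b`, which stays in the trivializing neighborhood of `y` if it contains
`b`. -/
noncomputable def localPath [PathConnectedSpace X] (y b : X) : Path y b :=
  if h : b ∈ L.nhd y then ((L.isPathConnected_nhd y).joinedIn y (L.mem_nhd y) b h).somePath
  else PathConnectedSpace.somePath y b

theorem localPath_mem [PathConnectedSpace X] {y b : X} (h : b ∈ L.nhd y) (t : I) :
    L.localPath y b t ∈ L.nhd y := by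
  rw [localPath, dif_pos h]
  exact JoinedIn.somePath_mem _ t

theorem transport_localPath_self [PathConnectedSpace X] (y : X) (f : F) :
    L.transport (.mk (L.localPath y y)) f = f :=
  L.transport_loop _ (L.localPath_mem (L.mem_nhd y)) f

/-- Transport along a path in the neighborhood of `y` commutes with the transport along the local
paths. -/
theorem transport_localPath [PathConnectedSpace X] {y b b' : X} (p : Path b b')
    (hp : ∀ t, p t ∈ L.nhd y) (f : F) :
    L.transport (.mk (L.localPath y b')) f =
      L.transport (.mk p) (L.transport (.mk (L.localPath y b)) f) := by
  have hb : b ∈ L.nhd y := p.source ▸ hp 0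
  have hb' : b' ∈ L.nhd y := p.target ▸ hp 1
  rw [← L.transport_trans, ← Path.Homotopic.Quotient.mk_trans]
  refine L.transport_eq_of_mem _ _ (L.localPath_mem hb') (fun t => ?_) f
  have : (L.localPath y b).trans p t ∈ Set.range ((L.localPath y b).trans p) := ⟨t, rfl⟩
  rw [Path.trans_range] at this
  rcases this with ⟨s, hs⟩ | ⟨s, hs⟩ <;> rw [← hs]
  exacts [L.localPath_mem hb s, hp s]

theorem transport_localPath_symm [PathConnectedSpace X] {y b b' : X} (p : Path b b')
    (hp : ∀ t, p t ∈ L.nhd y) (f : F) :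
    L.transport (.symm (.mk (L.localPath y b'))) (L.transport (.mk p) f) =
      L.transport (.symm (.mk (L.localPath y b))) f := by
  conv_lhs => rw [← L.transport_transport_symm (.mk (L.localPath y b)) f,
    ← L.transport_localPath p hp, L.transport_symm_transport]

/-- A map to `F` which over small parts of a path is obtained by transport is obtained by transport
along the whole path. -/
theorem transport_subpath_zero_one [PathConnectedSpace X] {a b : X} (γ : Path a b) (φ : I → F)
    (h : ∀ t₀, ∀ᶠ t in 𝓝 t₀,
      L.transport (.symm (.mk (L.localPath (γ t₀) (γ t)))) (φ t) = φ t₀) :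
    L.transport (.mk (γ.subpath 0 1)) (φ 0) = φ 1 := by
  -- Carrying `φ t` back to time 0 along `γ` gives a locally constant function, hence a constant
  -- one; times 0 and 1 are then compared.
  let g (t : I) : F := L.transport (.symm (.mk (γ.subpath 0 t))) (φ t)
  have hg : IsLocallyConstant g := by
    rw [IsLocallyConstant.iff_eventually_eq]
    intro t₀
    have hnhd : ∀ᶠ t in 𝓝 t₀, Set.uIcc t₀ t ⊆ γ ⁻¹' L.nhd (γ t₀) :=
      Filter.tendsto_smallSets_iff.mp (tendsto_const_nhds.uIcc Filter.tendsto_id) _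
        (((L.isOpen_nhd _).preimage γ.continuous).mem_nhds (L.mem_nhd _))
    filter_upwards [h t₀, hnhd] with t ht hsub
    have hp (s : I) : γ.subpath t₀ t s ∈ L.nhd (γ t₀) := by
      obtain ⟨r, hr, h⟩ := (γ.range_subpath t₀ t).le ⟨s, rfl⟩
      exact h ▸ hsub hr
    have h1 : φ t = L.transport (.mk (γ.subpath t₀ t)) (φ t₀) := by
      rw [← L.transport_localPath_self (γ t₀) (φ t₀), ← L.transport_localPath _ hp, ← ht,
        L.transport_transport_symm]
    have h2 : L.transport (.mk (γ.subpath 0 t)) (g t₀) = φ t := by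
      rw [← Path.Homotopic.Quotient.eq.mpr ⟨Path.Homotopy.subpathTransSubpath γ 0 t₀ t⟩,
        Path.Homotopic.Quotient.mk_trans, L.transport_trans, L.transport_transport_symm, h1]
    exact (congrArg _ h2).symm.trans (L.transport_symm_transport _ _)
  have h1 : g 1 = g 0 := hg.apply_eq_of_isPreconnected isPreconnected_univ trivial trivial
  have h0 : g 0 = φ 0 := by
    have := L.transport_symm_transport (.mk (γ.subpath 0 0)) (φ 0)
    rwa [γ.subpath_self, Path.Homotopic.Quotient.mk_refl, L.transport_refl,
      ← Path.Homotopic.Quotient.mk_refl, ← γ.subpath_self] at this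
  rw [← h0, ← h1, L.transport_transport_symm]

variable [TopologicalSpace F] [DiscreteTopology F] [PathConnectedSpace X]
  [LocallyPathConnectedSpace X]

/-- The gluing data of the covering space defined by a local system. -/
noncomputable def core : FiberBundleCore X X F where
  baseSet := L.nhd
  isOpen_baseSet := L.isOpen_nhd
  indexAt := id
  mem_baseSet_at := L.mem_nhd
  -- The chart at `y` identifies the fiber over `b` with that over `y` through the local path, so
  -- the change of charts runs from `y` out to `b` and back to `z`.
  coordChange y z b f :=
    L.transport (.symm (.mk (L.localPath z b))) (L.transport (.mk (L.localPath y b)) f)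
  coordChange_self y b _ f := L.transport_symm_transport _ f
  continuousOn_coordChange y z := by
    refine continuousOn_prod_of_discrete_right.mpr fun f b hb => ?_
    have hb' : b ∈ L.nhd y ∩ L.nhd z := hb.1
    obtain ⟨W, ⟨hW, hbW, hWc⟩, hWs⟩ := (isOpen_isPathConnected_basis b).mem_iff.mp
      (((L.isOpen_nhd y).inter (L.isOpen_nhd z)).mem_nhds hb')
    refine ContinuousAt.continuousWithinAt ((continuousAt_const (y := L.transport
      (.symm (.mk (L.localPath z b))) (L.transport (.mk (L.localPath y b)) f))).congr
      (Filter.mem_of_superset (hW.mem_nhds hbW) fun b' hb' => ?_))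
    -- Replacing `b` by `b'` extends both local paths by `p`, as far as transport is concerned, and
    -- `p` cancels: the coordinate change is constant on `W`.
    obtain ⟨p, hp⟩ := hWc.joinedIn b hbW b' hb'
    dsimp only [Set.mem_ofPred_eq]
    rw [L.transport_localPath p fun t => (hWs (hp t)).1,
      L.transport_localPath_symm p fun t => (hWs (hp t)).2]
  coordChange_comp y z w b _ f := by rw [L.transport_transport_symm]

/-- A path in the covering space of a local system moves by transport along its projection. -/
theorem transport_proj (Γ : C(I, L.core.TotalSpace)) :
    L.transport (.mk (⟨⟨fun t => (Γ t).1, L.core.continuous_proj.comp Γ.continuous⟩, rfl, rfl⟩ :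
      Path (Γ 0).1 (Γ 1).1)) (Γ 0).2 = (Γ 1).2 := by
  let γ : Path (Γ 0).1 (Γ 1).1 :=
    ⟨⟨fun t => (Γ t).1, L.core.continuous_proj.comp Γ.continuous⟩, rfl, rfl⟩
  have h1 : γ.subpath 0 1 = γ := γ.subpath_zero_one
  refine (congrArg (fun δ => L.transport (.mk δ) (Γ 0).2) h1).symm.trans
    (L.transport_subpath_zero_one γ (fun t => (Γ t).2) fun t₀ => ?_)
  -- The chart coordinate is continuous into the discrete `F`, hence locally constant. Charts are
  -- indexed by points, and the local path from a point to itself acts trivially, so this is the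
  -- hypothesis of `transport_subpath_zero_one`.
  have hcont : ContinuousAt (fun t => ((L.core.localTrivAt (γ t₀)) (Γ t)).2) t₀ :=
    continuousAt_snd.comp (ContinuousAt.comp
      ((L.core.localTrivAt (γ t₀)).continuousAt (L.core.mem_localTrivAt_baseSet _))
      Γ.continuous.continuousAt)
  filter_upwards [hcont.eventually_mem ((isOpen_discrete {_}).mem_nhds rfl)] with t ht
  have ht' : L.core.coordChange (γ t) (γ t₀) (γ t) (Γ t).2 = (Γ t₀).2 :=
    Eq.trans ht (L.core.coordChange_self (γ t₀) (γ t₀) (L.mem_nhd _) (Γ t₀).2)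
  exact (congrArg _ (L.transport_localPath_self (γ t) (Γ t).2)).symm.trans ht'

end LocalSystem

/-! ### Monodromy and connectedness of the glued covering -/

namespace LocalSystem

variable {X : Type u} [TopologicalSpace X] {F : Type u} (L : LocalSystem X F)
  [TopologicalSpace F] [DiscreteTopology F] [PathConnectedSpace X] [LocallyPathConnectedSpace X]

/-- A form of `transport_proj` for a prescribed path with prescribed ends, so that it applies to the
lifts that define monodromy. -/
theorem apply_one_eq_of_lift {y z : X} (c : Path y z) (f : F) (Γ : C(I, L.core.TotalSpace))
    (h0 : Γ 0 = ⟨y, f⟩) (hΓ : ∀ t, (Γ t).1 = c t) : Γ 1 = ⟨z, L.transport (.mk c) f⟩ := by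
  obtain rfl : y = (Γ 0).1 := c.source.symm.trans (hΓ 0).symm
  obtain rfl : z = (Γ 1).1 := c.target.symm.trans (hΓ 1).symm
  obtain rfl : (Γ 0).2 = f := Bundle.TotalSpace.mk_inj.mp h0
  obtain rfl : (⟨⟨fun t => (Γ t).1, L.core.continuous_proj.comp Γ.continuous⟩, rfl, rfl⟩ :
      Path (Γ 0).1 (Γ 1).1) = c := Path.ext (funext hΓ)
  rw [L.transport_proj]

theorem isCoveringMap_proj : IsCoveringMap L.core.proj :=
  FiberBundle.isCoveringMap

theorem monodromy_proj {y z : X} (c : Path.Homotopic.Quotient y z) (f : F) :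
    L.isCoveringMap_proj.monodromy c ⟨⟨y, f⟩, rfl⟩ = ⟨⟨z, L.transport c f⟩, rfl⟩ := by
  obtain ⟨c⟩ := c
  exact Subtype.ext (L.apply_one_eq_of_lift c f _ (L.isCoveringMap_proj.liftPath_zero ..)
    (congr_fun (L.isCoveringMap_proj.liftPath_lifts ..)))

theorem joined_transport {y z : X} (c : Path.Homotopic.Quotient y z) (f : F) :
    Joined (⟨y, f⟩ : L.core.TotalSpace) ⟨z, L.transport c f⟩ := by
  have h := L.isCoveringMap_proj.liftPathQuotient c ⟨⟨y, f⟩, rfl⟩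
  rw [L.monodromy_proj] at h
  obtain ⟨γ⟩ := h
  exact ⟨γ⟩

theorem connectedSpace_totalSpace {x : X} (f : F)
    (h : ∀ z f', ∃ c : Path.Homotopic.Quotient x z, L.transport c f = f') :
    ConnectedSpace L.core.TotalSpace := by
  have key (e : L.core.TotalSpace) : Joined (⟨x, f⟩ : L.core.TotalSpace) e := by
    obtain ⟨z, f'⟩ := e
    obtain ⟨c, rfl⟩ := h z f'
    exact L.joined_transport c f
  have : PathConnectedSpace L.core.TotalSpace :=
    ⟨⟨⟨x, f⟩⟩, fun e e' => (key e).symm.trans (key e')⟩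
  infer_instance

/-- The connected covering space of a transitive local system. -/
noncomputable def covering {x : X} (f : F)
    (h : ∀ z f', ∃ c : Path.Homotopic.Quotient x z, L.transport c f = f') :
    ConnectedCovering X :=
  have := L.connectedSpace_totalSpace f h
  { E := L.core.TotalSpace
    proj := ⟨L.core.proj, L.core.continuous_proj⟩
    isCovering := L.isCoveringMap_proj }

/-- The image subgroup is the monodromy stabilizer, and the monodromy is the transport. -/
theorem exists_covering {x : X} (f : F)
    (h : ∀ z f', ∃ c : Path.Homotopic.Quotient x z, L.transport c f = f') :
    ∃ (p : ConnectedCovering X) (e : p.E) (he : p.proj e = x),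
      ∀ g, g ∈ p.imageSubgroup e he ↔ L.transport g.toPath f = f := by
  refine ⟨L.covering f h, (⟨x, f⟩ : L.core.TotalSpace), rfl, fun g => ?_⟩
  have h1 := L.isCoveringMap_proj.range_mapOfEq_eq_stabilizer (⟨x, f⟩ : L.core.TotalSpace) rfl
  have h2 : g ∈ (L.covering f h).imageSubgroup (⟨x, f⟩ : L.core.TotalSpace) rfl ↔
      L.isCoveringMap_proj.monodromy g.toPath ⟨⟨x, f⟩, rfl⟩ = ⟨⟨x, f⟩, rfl⟩ :=
    (SetLike.ext_iff.mp h1 g).trans Iff.rfl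
  refine h2.trans ?_
  rw [L.monodromy_proj]
  exact Subtype.mk_eq_mk.trans Bundle.TotalSpace.mk_inj

end LocalSystem

/-! ### From subgroups with open core to local systems of cosets -/

/-- Paths close to a constant path are those with values in a neighborhood of the point. -/
theorem Path.exists_isOpen_of_mem_nhds_refl {X : Type*} [TopologicalSpace X] {y : X}
    {O : Set (Path y y)} (hO : O ∈ 𝓝 (Path.refl y)) :
    ∃ V : Set X, IsOpen V ∧ y ∈ V ∧ ∀ l : Path y y, (∀ t, l t ∈ V) → l ∈ O := by
  let S (V : Set X) : Set (Path y y) := {l | ∀ t, l t ∈ V}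
  have hS : Monotone S := fun _ _ hst _ hl t => hst (hl t)
  -- Convergence to the constant path is tested on the subbasic sets of maps sending a compact `K`
  -- into an open `U`. If `K` is empty, `U` may miss `y`, but the condition is void.
  have h : Filter.Tendsto (fun γ : Path y y => (γ : C(I, X))) ((𝓝 y).lift' S)
      (𝓝 (Path.refl y : C(I, X))) := by
    rw [ContinuousMap.tendsto_nhds_compactOpen]
    intro K _ U hU hKU
    obtain rfl | ⟨t, ht⟩ := K.eq_empty_or_nonempty
    · exact .of_forall fun _ _ h => h.elim
    · exact Filter.mem_of_superset (Filter.mem_lift' (hU.mem_nhds (hKU ht)))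
        fun l hl s _ => hl s
  rw [nhds_induced] at hO
  obtain ⟨V, hV, hVO⟩ := (Filter.mem_lift'_sets hS).mp (h.le_comap hO)
  obtain ⟨W, hWV, hW, hyW⟩ := mem_nhds_iff.mp hV
  exact ⟨W, hW, hyW, fun l hl => hVO fun t => hWV (hl t)⟩

namespace FundamentalGroup

variable {X : Type u} [TopologicalSpace X] {x : X}

/-- The loop at `x` obtained from a path class by joining its ends to `x`. -/
noncomputable def closeUp (α : ∀ y, Path x y) {y z : X} (c : Path.Homotopic.Quotient y z) :
    FundamentalGroup X x :=
  fromPath (((Path.Homotopic.Quotient.mk (α y)).trans c).trans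
    (Path.Homotopic.Quotient.mk (α z)).symm)

theorem closeUp_refl (α : ∀ y, Path x y) (y : X) : closeUp α (.refl y) = 1 := by
  rw [closeUp, Path.Homotopic.Quotient.trans_refl, Path.Homotopic.Quotient.trans_symm]
  rfl

/-- The product of the fundamental group composes from right to left. The reversal makes `closeUp`
act on left cosets compatibly with concatenation. -/
theorem closeUp_trans (α : ∀ y, Path x y) {y z w : X} (c : Path.Homotopic.Quotient y z)
    (d : Path.Homotopic.Quotient z w) :
    closeUp α (c.trans d) = closeUp α d * closeUp α c := by
  have key {a b : X} (p : Path.Homotopic.Quotient a y) (q : Path.Homotopic.Quotient a z)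
      (r : Path.Homotopic.Quotient w b) : (p.trans (c.trans d)).trans r =
        ((p.trans c).trans q.symm).trans ((q.trans d).trans r) := by
    simp only [Path.Homotopic.Quotient.trans_assoc]
    rw [← Path.Homotopic.Quotient.trans_assoc q.symm, Path.Homotopic.Quotient.symm_trans,
      Path.Homotopic.Quotient.refl_trans]
  exact key _ _ _

theorem exists_closeUp_eq (α : ∀ y, Path x y) (y z : X) (g : FundamentalGroup X x) :
    ∃ c : Path.Homotopic.Quotient y z, closeUp α c = g := by
  refine ⟨((Path.Homotopic.Quotient.mk (α y)).symm.trans g.toPath).trans (.mk (α z)), ?_⟩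
  simp only [closeUp, Path.Homotopic.Quotient.trans_assoc, Path.Homotopic.Quotient.trans_symm,
    Path.Homotopic.Quotient.trans_refl]
  rw [← Path.Homotopic.Quotient.trans_assoc, Path.Homotopic.Quotient.trans_symm,
    Path.Homotopic.Quotient.refl_trans]

/-- Small loops act trivially modulo a subgroup with open core. -/
theorem HasOpenCore.exists_nhd [LocallyPathConnectedSpace X] {H : Subgroup (FundamentalGroup X x)}
    (hH : HasOpenCore H) (α : ∀ y, Path x y) (y : X) :
    ∃ V : Set X, IsOpen V ∧ y ∈ V ∧ IsPathConnected V ∧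
      ∀ l : Path y y, (∀ t, l t ∈ V) → closeUp α (.mk l) ∈ H.normalCore := by
  have hc : Continuous fun l : Path y y => ((α y).trans l).trans (α y).symm :=
    Path.continuous_trans.comp ((Path.continuous_trans.comp
      (continuous_const.prodMk continuous_id)).prodMk continuous_const)
  have hO : IsOpen {l : Path y y | closeUp α (.mk l) ∈ H.normalCore} :=
    (isOpen_coinduced.mp hH).preimage hc
  have hrefl : closeUp α (.mk (Path.refl y)) ∈ H.normalCore := by
    rw [Path.Homotopic.Quotient.mk_refl, closeUp_refl]
    exact one_mem _
  obtain ⟨V, hV, hyV, hl⟩ := Path.exists_isOpen_of_mem_nhds_refl (hO.mem_nhds hrefl)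
  obtain ⟨W, ⟨hW, hyW, hWc⟩, hWV⟩ := (isOpen_isPathConnected_basis y).mem_iff.mp (hV.mem_nhds hyV)
  exact ⟨W, hW, hyW, hWc, fun l h => hl l fun t => hWV (h t)⟩

end FundamentalGroup

/-- Fixing the coset of `k` means that the conjugate of `n` by the inverse of `k` lies in `H`; for
all `k` together this is membership in the core, not just in `H`. -/
theorem Subgroup.smul_quotient_of_mem_normalCore {G : Type*} [Group G] {H : Subgroup G} {n : G}
    (hn : n ∈ H.normalCore) (f : G ⧸ H) : n • f = f := by
  induction f using QuotientGroup.induction_on with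
  | H k =>
    refine (QuotientGroup.eq.mpr ?_ : ((n * k : G) : G ⧸ H) = k)
    have := inv_mem hn k⁻¹
    simpa [mul_assoc] using this

/-- The local system with fiber the cosets of a subgroup with open core. -/
noncomputable def FundamentalGroup.HasOpenCore.localSystem {X : Type u} [TopologicalSpace X]
    [LocallyPathConnectedSpace X] {x : X} {H : Subgroup (FundamentalGroup X x)}
    (hH : HasOpenCore H) (α : ∀ y, Path x y) : LocalSystem X (FundamentalGroup X x ⧸ H) where
  transport c f := closeUp α c • f
  transport_refl y f := by rw [closeUp_refl, one_smul]
  transport_trans c d f := by rw [closeUp_trans, mul_smul]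
  nhd y := (hH.exists_nhd α y).choose
  isOpen_nhd y := (hH.exists_nhd α y).choose_spec.1
  mem_nhd y := (hH.exists_nhd α y).choose_spec.2.1
  isPathConnected_nhd y := (hH.exists_nhd α y).choose_spec.2.2.1
  transport_loop {y} l hl f :=
    Subgroup.smul_quotient_of_mem_normalCore ((hH.exists_nhd α y).choose_spec.2.2.2 l hl) f

/-- Every subgroup with open core comes, up to conjugacy, from a connected covering space. -/
theorem FundamentalGroup.HasOpenCore.exists_covering {X : Type u} [TopologicalSpace X]
    [PathConnectedSpace X] [LocallyPathConnectedSpace X] {x : X}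
    {H : Subgroup (FundamentalGroup X x)} (hH : HasOpenCore H) :
    ∃ (p : ConnectedCovering X) (e : p.E) (he : p.proj e = x),
      Subgroup.ConjRel (p.imageSubgroup e he) H := by
  let α (y : X) : Path x y := PathConnectedSpace.somePath x y
  let L := hH.localSystem α
  let _ : TopologicalSpace (FundamentalGroup X x ⧸ H) := ⊥
  have : DiscreteTopology (FundamentalGroup X x ⧸ H) := ⟨rfl⟩
  let f : FundamentalGroup X x ⧸ H := QuotientGroup.mk 1
  have h (z : X) (f' : FundamentalGroup X x ⧸ H) :
      ∃ c : Path.Homotopic.Quotient x z, L.transport c f = f' := by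
    induction f' using QuotientGroup.induction_on with
    | H k =>
      obtain ⟨c, rfl⟩ := exists_closeUp_eq α x z k
      exact ⟨c, congrArg QuotientGroup.mk (mul_one _)⟩
  obtain ⟨p, e, he, hp⟩ := L.exists_covering f h
  refine ⟨p, e, he, ?_⟩
  -- The path `α x` need not be constant, so closing up a loop at `x` conjugates it by `a`. The
  -- stabilizer of the trivial coset is therefore the conjugate of `H` by `a`, whence the witness
  -- `a⁻¹`.
  let a : FundamentalGroup X x := fromPath (.mk (α x))
  have ha (g : FundamentalGroup X x) : closeUp α g.toPath = a⁻¹ * (g * a) := rfl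
  refine ⟨a⁻¹, Subgroup.ext fun k => ?_⟩
  have hk : (MulAut.conj a⁻¹).symm k = a * k * a⁻¹ := by simp
  have hk' : closeUp α (toPath (a * k * a⁻¹)) = k := by
    rw [ha]
    simp only [mul_assoc, inv_mul_cancel, inv_mul_cancel_left, mul_one]
  refine .trans ?_ (Subgroup.mem_map_equiv (f := MulAut.conj a⁻¹) (K := p.imageSubgroup e he)).symm
  rw [hk, hp]
  change k ∈ H ↔ closeUp α (toPath (a * k * a⁻¹)) • f = f
  rw [hk', ← MulAction.mem_stabilizer_iff, MulAction.stabilizer_quotient]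

/-! ### The classification -/

theorem theorem3p7 {X : Type u} [TopologicalSpace X] [ConnectedSpace X]
    [LocallyPathConnectedSpace X] (x : X) :
    ∃ Φ : ConnectedCovering.Classes X ≃ FundamentalGroup.OpenCoreConjClasses x,
      ∀ p : ConnectedCovering X,
        (∃ e : p.E, p.proj e = x) ∧
        ∀ (e : p.E) (he : p.proj e = x),
          ∃ hopen : FundamentalGroup.HasOpenCore (p.imageSubgroup e he),
            Φ (Quotient.mk (ConnectedCovering.setoid X) p) =
              Quotient.mk (FundamentalGroup.openCoreSetoid x)
                ⟨p.imageSubgroup e he, hopen⟩ := by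
  have : PathConnectedSpace X := .of_locallyPathConnectedSpace
  choose e he using fun p : ConnectedCovering X => p.surjective x
  let φ (p : ConnectedCovering X) : FundamentalGroup.OpenCoreConjClasses x :=
    Quotient.mk (FundamentalGroup.openCoreSetoid x)
      ⟨p.imageSubgroup (e p) (he p), p.hasOpenCore_imageSubgroup _ _⟩
  have hφ (p : ConnectedCovering X) (e' : p.E) (he' : p.proj e' = x) :
      φ p = Quotient.mk (FundamentalGroup.openCoreSetoid x)
        ⟨p.imageSubgroup e' he', p.hasOpenCore_imageSubgroup _ _⟩ :=
    Quotient.sound (p.conjRel_imageSubgroup _ _ _ _)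
  have hwd (p q : ConnectedCovering X) (hpq : (ConnectedCovering.setoid X) p q) : φ p = φ q := by
    obtain ⟨h, hh⟩ := hpq
    rw [hφ q (h (e p)) ((hh _).trans (he p))]
    exact congrArg _ (Subtype.ext (p.imageSubgroup_eq_of_equiv q (e p) (he p) h hh))
  let Φ : ConnectedCovering.Classes X → FundamentalGroup.OpenCoreConjClasses x :=
    Quotient.lift φ hwd
  have hΦ : Function.Bijective Φ := by
    constructor
    · rintro ⟨p⟩ ⟨q⟩ h
      -- Moving the base point in the fiber of `p` turns conjugate subgroups into equal ones, as the
      -- lifting criterion requires.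
      obtain ⟨e', he', h'⟩ := p.exists_imageSubgroup_eq_of_conjRel (e p) (he p)
        (Quotient.exact h : Subgroup.ConjRel _ _)
      exact Quotient.sound (ConnectedCovering.equiv_of_imageSubgroup_eq p q he' (he q) h')
    · rintro ⟨⟨H, hH⟩⟩
      obtain ⟨p, e', he', h⟩ := hH.exists_covering
      exact ⟨Quotient.mk _ p, (hφ p e' he').trans (Quotient.sound h)⟩
  exact ⟨Equiv.ofBijective Φ hΦ, fun p => ⟨p.surjective x, fun e' he' =>
    ⟨p.hasOpenCore_imageSubgroup e' he', hφ p e' he'⟩⟩⟩
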